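/- Let $\mathbb{D}=\{z\in\mathbb{C}:|z|<1\}$, $\mathbb{D}(z,r)=\{\zeta\in\mathbb{C}:|\zeta-z|<r\}$, and let $d(z)$ be the Euclidean distance from $z$ to $\partial\mathbb{D}$. A majorant is a continuous increasing (not necessarily strictly increasing) function $\omega:[0,\infty)\to[0,\infty)$ with $\omega(0)=0$, such that $\omega(t)/t$ is non-increasing for $t>0$. For a majorant $\omega$ and $\alpha>0$, let $\mathcal{B}_\omega^\alpha$ be the set of all $f\in\mathcal{C}^1(\mathbb{D})$ (complex-valued, real differentiability) with $$\sup_{z\in\mathbb{D}}\big\{\|D_f(z)\|\,\omega\big(d(z)^\alpha\big)\big\}<+\infty,$$ where $D_f(z)$ is the real Jacobian matrix of $f$ at $z$ and $\|A\|=\sup\{|Ax|:|x|=1\}$. Theorem. Let $g:\overline{\mathbb{D}}\to\mathbb{C}$ be continuous, and let $f:\overline{\mathbb{D}}\to\mathbb{C}$ be continuous on $\overline{\mathbb{D}}$, twice continuously (real) differentiable in $\mathbb{D}$, with $\Delta f=g$ in $\mathbb{D}$. Let $1\le\alpha<2$ and let $\omega$ be a majorant that is not identically zero. Then the following statements are equivalent: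 (1) $f\in\mathcal{B}_\omega^\alpha$; (2) there exists a constant $C>0$ such that for all $z\in\mathbb{D}$ and all $r\in(0,d(z)]$, $$\frac{1}{|\mathbb{D}(z,r)|}\int_{\mathbb{D}(z,r)}|f(\zeta)-f(z)|\,dA(\zeta)\le C\,\frac{r}{\omega(r^\alpha)},$$ where $dA$ is Lebesgue area measure and $|\mathbb{D}(z,r)|$ is the area of $\mathbb{D}(z,r)$. -/

import Mathlib

/-- A majorant: a continuous increasing function `ω` on `[0, ∞)` with `ω 0 = 0` such that
`ω t / t` is non-increasing for `t > 0` (values of `ω` at negative reals are irrelevant).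
"Increasing" is read in the weak sense; nonnegativity follows from `ω 0 = 0`. -/
structure IsMajorant (ω : ℝ → ℝ) : Prop where
  continuousOn : ContinuousOn ω (Set.Ici 0)
  monotoneOn : MonotoneOn ω (Set.Ici 0)
  map_zero : ω 0 = 0
  antitoneOn_div : AntitoneOn (fun t => ω t / t) (Set.Ioi 0)

/-- The class of solutions of Poisson's equation `Δ f = g` on `Ω` that are twice continuously
(real) differentiable in `Ω` and continuous on the closure of `Ω`. -/
structure IsPoissonSolution (g : ℂ → ℂ) (Ω : Set ℂ) (f : ℂ → ℂ) : Prop where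
  continuousOn_closure : ContinuousOn f (closure Ω)
  contDiffOn : ContDiffOn ℝ 2 f Ω
  laplacian_eq : ∀ z ∈ Ω, Laplacian.laplacian f z = g z

/-- The open unit disk. -/
def unitDisk : Set ℂ := Metric.ball 0 1

/-- Euclidean distance to the boundary of the unit disk. -/
noncomputable def distBdry (z : ℂ) : ℝ := Metric.infDist z (frontier unitDisk)

/-- Bloch type mappings: `f` is `C¹` in the unit disk and
`sup_z ‖D_f(z)‖ ω(d(z)^α) < ∞`, where `‖D_f(z)‖` is the operator norm of the real derivative. -/
structure IsBlochType (ω : ℝ → ℝ) (α : ℝ) (f : ℂ → ℂ) : Prop where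
  contDiffOn : ContDiffOn ℝ 1 f unitDisk
  bddAbove : BddAbove ((fun z => ‖fderiv ℝ f z‖ * ω (distBdry z ^ α)) '' unitDisk)

/-! For (1) ⇒ (2), pick `β` strictly between `α` and 2. With `q = r - |w - z| ≤ d(w)`, monotonicity
of `ω` and of `ω(t)/t` gives `ω(d(w)^α) ≥ (q/r)^β ω(r^α)`, so the derivative is at most a constant
times `(r^β / ω(r^α)) q^(-β)`. Integrating along the radius leaves `q^(1-β)`, which is integrable
over the disk because `β < 2`; scaling yields `r / ω(r^α)` (`setAverage_norm_sub_center_le`).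

For (2) ⇒ (1), the gradient is read off the first Fourier mode `H(ρ) = ∫ cos(θ-t) f(ρ e^{iθ}) dθ`,
for which `H'(0) = π Df(0) e^{it}`. Up to an error governed by `Δf`, `H` is linear in `ρ`
(`norm_fourierMode_sub_le`), while `|H(ρ)|` is at most the integral of `|f - f(0)|` over the circle.
Integrating over circles bounds the gradient by the mean oscillation plus `M s / 2`, where `|Δf| ≤
M` (`norm_fderiv_le_of_laplacian_le`). Here `M` bounds `g` on the closed disk; taking `s = d(z)/2`,
the doubling property of `ω` finishes the argument. -/

open MeasureTheory Set Filter Topology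

/-! ### Calculus along rays and circles. -/

/-- Differentiation under the integral sign for jointly continuous integrands. -/
theorem hasDerivAt_intervalIntegral_of_continuous {E : Type*} [NormedAddCommGroup E]
    [NormedSpace ℝ E] {F F' : ℝ → ℝ → E}
    (hF : Continuous (Function.uncurry F)) (hF' : Continuous (Function.uncurry F'))
    (hd : ∀ x θ, HasDerivAt (fun y => F y θ) (F' x θ) x) (a b x : ℝ) :
    HasDerivAt (fun y => ∫ θ in a..b, F y θ) (∫ θ in a..b, F' x θ) x := by
  have hsec : ∀ y, Continuous (F y) := fun y => hF.comp (Continuous.prodMk_right y)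
  have hsec' : ∀ y, Continuous (F' y) := fun y => hF'.comp (Continuous.prodMk_right y)
  obtain ⟨C, hC⟩ := ((isCompact_closedBall x 1).prod (isCompact_uIcc (a := a) (b := b))).exists_bound_of_continuousOn
    hF'.continuousOn
  refine (intervalIntegral.hasDerivAt_integral_of_dominated_loc_of_deriv_le
    (bound := fun _ => C) (Metric.closedBall_mem_nhds x one_pos) ?_ ?_ ?_ ?_ ?_ ?_).2
  · exact Eventually.of_forall fun y => (hsec y).aestronglyMeasurable
  · exact (hsec x).intervalIntegrable _ _
  · exact (hsec' x).aestronglyMeasurable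
  · exact Eventually.of_forall fun θ hθ y hy => hC (y, θ) ⟨hy, uIoc_subset_uIcc hθ⟩
  · exact intervalIntegrable_const
  · exact Eventually.of_forall fun θ _ y _ => hd y θ

theorem hasDerivAt_ofReal_mul_const (ρ : ℝ) (w : ℂ) : HasDerivAt (fun y : ℝ => (y : ℂ) * w) w ρ := by
  simpa using (Complex.ofRealCLM.hasDerivAt (x := ρ)).mul_const w

theorem hasDerivAt_const_mul_exp_mul_I (w : ℂ) (θ : ℝ) :
    HasDerivAt (fun y : ℝ => w * Complex.exp (y * Complex.I))
      (w * (Complex.exp (θ * Complex.I) * Complex.I)) θ := by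
  have h := ((hasDerivAt_ofReal_mul_const θ Complex.I).cexp).const_mul w
  exact h

/-! ### First Fourier mode on circles and the gradient at the origin. -/

section Radial

variable {f : ℂ → ℂ}

theorem ContDiff.continuous_fderiv_fderiv (hf : ContDiff ℝ 2 f) :
    Continuous (fderiv ℝ (fderiv ℝ f)) :=
  (hf.fderiv_right (m := 1) (by norm_num)).continuous_fderiv one_ne_zero

theorem ContDiff.hasDerivAt_comp_of_two (hf : ContDiff ℝ 2 f) {p : ℝ → ℂ} {p' : ℂ} {x : ℝ}
    (hp : HasDerivAt p p' x) : HasDerivAt (fun y => f (p y)) (fderiv ℝ f (p x) p') x :=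
  ((hf.differentiable two_ne_zero (p x)).hasFDerivAt).comp_hasDerivAt x hp

theorem ContDiff.hasDerivAt_fderiv_comp_apply (hf : ContDiff ℝ 2 f) {p q : ℝ → ℂ} {p' q' : ℂ}
    {x : ℝ} (hp : HasDerivAt p p' x) (hq : HasDerivAt q q' x) :
    HasDerivAt (fun y => fderiv ℝ f (p y) (q y))
      (fderiv ℝ (fderiv ℝ f) (p x) p' (q x) + fderiv ℝ f (p x) q') x := by
  have h1 : Differentiable ℝ (fderiv ℝ f) :=
    (hf.fderiv_right (m := 1) (by norm_num)).differentiable one_ne_zero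
  exact ((h1 (p x)).hasFDerivAt.comp_hasDerivAt x hp).clm_apply hq

/-- The Laplacian in the orthonormal frame `exp (iθ)`, `i exp (iθ)`. -/
theorem laplacian_eq_fderiv_fderiv_rotated (f : ℂ → ℂ) (x : ℂ) (θ : ℝ) :
    Laplacian.laplacian f x =
      fderiv ℝ (fderiv ℝ f) x (Complex.exp (θ * Complex.I)) (Complex.exp (θ * Complex.I)) +
      fderiv ℝ (fderiv ℝ f) x (Complex.exp (θ * Complex.I) * Complex.I)
        (Complex.exp (θ * Complex.I) * Complex.I) := by
  have h1 : Complex.exp (θ * Complex.I) = Real.cos θ • (1 : ℂ) + Real.sin θ • Complex.I := by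
    rw [Complex.exp_mul_I]; simp
  have h2 : Complex.exp (θ * Complex.I) * Complex.I
      = (-Real.sin θ) • (1 : ℂ) + Real.cos θ • Complex.I := by
    rw [Complex.exp_mul_I]
    simp only [Complex.real_smul, Complex.ofReal_neg, Complex.ofReal_sin, Complex.ofReal_cos]
    linear_combination Complex.sin θ * Complex.I_mul_I
  rw [InnerProductSpace.laplacian_eq_iteratedFDeriv_complexPlane, h2, h1]
  simp only [iteratedFDeriv_two_apply, map_add, map_smul, add_apply, smul_apply,
    Matrix.cons_val_zero, Matrix.cons_val_one]
  simp only [Complex.real_smul]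
  have h3 : (Real.sin θ : ℂ) ^ 2 + (Real.cos θ : ℂ) ^ 2 = 1 := by
    exact_mod_cast Real.sin_sq_add_cos_sq θ
  push_cast at h3 ⊢
  linear_combination (-(fderiv ℝ (fderiv ℝ f) x 1 1) -
    fderiv ℝ (fderiv ℝ f) x Complex.I Complex.I) * h3

/-- Two integrations by parts in the angular variable. -/
theorem integral_cos_smul_angular (hf : ContDiff ℝ 2 f) (t ρ : ℝ) :
    ∫ θ in (-Real.pi)..Real.pi, Real.cos (θ - t) •
      (ρ ^ 2 • fderiv ℝ (fderiv ℝ f) (ρ * Complex.exp (θ * Complex.I))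
          (Complex.exp (θ * Complex.I) * Complex.I) (Complex.exp (θ * Complex.I) * Complex.I)
        - ρ • fderiv ℝ f (ρ * Complex.exp (θ * Complex.I)) (Complex.exp (θ * Complex.I))
        + f (ρ * Complex.exp (θ * Complex.I))) = 0 := by
  have hc := hf.continuous
  have hc1 := hf.continuous_fderiv two_ne_zero
  have hc2 := hf.continuous_fderiv_fderiv
  -- The integrand is `cos(θ-t) (∂_θ² f + f)`, with primitive `cos(θ-t) ∂_θ f + sin(θ-t) f`; the
  -- primitive is `2π`-periodic.
  have hd : ∀ θ : ℝ, HasDerivAt (fun θ : ℝ => Real.cos (θ - t) •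
        fderiv ℝ f (ρ * Complex.exp (θ * Complex.I)) (ρ * (Complex.exp (θ * Complex.I) * Complex.I))
        + Real.sin (θ - t) • f (ρ * Complex.exp (θ * Complex.I)))
      (Real.cos (θ - t) •
      (ρ ^ 2 • fderiv ℝ (fderiv ℝ f) (ρ * Complex.exp (θ * Complex.I))
          (Complex.exp (θ * Complex.I) * Complex.I) (Complex.exp (θ * Complex.I) * Complex.I)
        - ρ • fderiv ℝ f (ρ * Complex.exp (θ * Complex.I)) (Complex.exp (θ * Complex.I))
        + f (ρ * Complex.exp (θ * Complex.I)))) θ := by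
    intro θ
    have hcos : HasDerivAt (fun θ : ℝ => Real.cos (θ - t)) (-Real.sin (θ - t)) θ := by
      simpa using ((hasDerivAt_id θ).sub_const t).cos
    have hsin : HasDerivAt (fun θ : ℝ => Real.sin (θ - t)) (Real.cos (θ - t)) θ := by
      simpa using ((hasDerivAt_id θ).sub_const t).sin
    have hp := hasDerivAt_const_mul_exp_mul_I ρ θ
    have hq : HasDerivAt (fun y : ℝ => (ρ : ℂ) * (Complex.exp (y * Complex.I) * Complex.I))
        (-((ρ : ℂ) * Complex.exp (θ * Complex.I))) θ := by
      have := (hasDerivAt_const_mul_exp_mul_I ρ θ).mul_const Complex.I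
      simp only [mul_assoc] at this
      refine this.congr_deriv ?_
      rw [Complex.I_mul_I]
      ring
    have h := (hcos.smul (hf.hasDerivAt_fderiv_comp_apply hp hq)).add
      (hsin.smul (hf.hasDerivAt_comp_of_two hp))
    refine h.congr_deriv ?_
    simp only [← Complex.real_smul, map_smul, map_neg, smul_apply]
    module
  rw [intervalIntegral.integral_eq_sub_of_hasDerivAt (fun θ _ => hd θ)
    (Continuous.intervalIntegrable (by fun_prop) _ _)]
  have e1 : Complex.exp (((-Real.pi : ℝ) : ℂ) * Complex.I) = -1 := by
    simp [Complex.exp_neg]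
  have e2 : Real.cos (-Real.pi - t) = Real.cos (Real.pi - t) := by
    rw [Real.cos_pi_sub, ← Real.cos_neg]; simp [Real.cos_add_pi]
  have e3 : Real.sin (-Real.pi - t) = Real.sin (Real.pi - t) := by
    rw [Real.sin_pi_sub, ← neg_add', Real.sin_neg, add_comm, Real.sin_add_pi, neg_neg]
  rw [e1, e2, e3, Complex.exp_pi_mul_I, sub_self]

/-- Since `cos(θ-t) e^{iθ} = (e^{i(2θ-t)} + e^{it}) / 2`, only the constant term survives. This
identifies `H'(0)` with `π Df(0) e^{it}`. -/
theorem integral_cos_smul_exp (t : ℝ) :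
    ∫ θ in (-Real.pi)..Real.pi, Real.cos (θ - t) • Complex.exp (θ * Complex.I)
      = (Real.pi : ℂ) * Complex.exp (t * Complex.I) := by
  have hd : ∀ θ : ℝ, HasDerivAt (fun θ : ℝ => Complex.exp ((2 * θ - t : ℂ) * Complex.I)
      / (4 * Complex.I) + θ * (Complex.exp (t * Complex.I) / 2))
      (Real.cos (θ - t) • Complex.exp (θ * Complex.I)) θ := by
    intro θ
    have h1 : HasDerivAt (fun θ : ℝ => (2 * θ - t : ℂ) * Complex.I) (2 * Complex.I) θ := by
      have := ((hasDerivAt_ofReal_mul_const θ (2 : ℂ)).sub_const (t : ℂ)).mul_const Complex.I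
      simpa only [mul_comm (2 : ℂ) (_ : ℂ)] using this
    refine ((h1.cexp.div_const (4 * Complex.I)).add
      (hasDerivAt_ofReal_mul_const θ (Complex.exp (t * Complex.I) / 2))).congr_deriv ?_
    have e1 : Complex.exp ((2 * θ - t : ℂ) * Complex.I)
        = Complex.exp ((θ - t : ℂ) * Complex.I) * Complex.exp (θ * Complex.I) := by
      rw [← Complex.exp_add]; ring_nf
    have e2 : Complex.exp (t * Complex.I)
        = Complex.exp (-(θ - t : ℂ) * Complex.I) * Complex.exp (θ * Complex.I) := by
      rw [← Complex.exp_add]; ring_nf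
    rw [Complex.real_smul, Complex.ofReal_cos, Complex.cos, e1, e2, Complex.ofReal_sub]
    have hI := Complex.I_ne_zero
    field_simp
    ring
  rw [intervalIntegral.integral_eq_sub_of_hasDerivAt (fun θ _ => hd θ)
    (Continuous.intervalIntegrable (by fun_prop) _ _)]
  have e : Complex.exp ((2 * ((-Real.pi : ℝ) : ℂ) - t) * Complex.I)
      = Complex.exp ((2 * (Real.pi : ℂ) - t) * Complex.I) := by
    rw [Complex.exp_eq_exp_iff_exists_int]
    exact ⟨-2, by push_cast; ring⟩
  rw [e]
  push_cast
  ring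

theorem integral_cos_sub_eq_zero (t : ℝ) :
    ∫ θ in (-Real.pi)..Real.pi, Real.cos (θ - t) = 0 := by
  rw [intervalIntegral.integral_comp_sub_right (fun θ => Real.cos θ), integral_cos,
    Real.sin_pi_sub, ← neg_add', Real.sin_neg, add_comm, Real.sin_add_pi, neg_neg, sub_self]

/-- The radial ordinary differential equation of the first Fourier mode of `f`. -/
theorem fourierMode_ode (hf : ContDiff ℝ 2 f) (t ρ : ℝ) :
    ρ ^ 2 • (∫ θ in (-Real.pi)..Real.pi, Real.cos (θ - t) •
        fderiv ℝ (fderiv ℝ f) (ρ * Complex.exp (θ * Complex.I))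
          (Complex.exp (θ * Complex.I)) (Complex.exp (θ * Complex.I)))
      + ρ • (∫ θ in (-Real.pi)..Real.pi, Real.cos (θ - t) •
        fderiv ℝ f (ρ * Complex.exp (θ * Complex.I)) (Complex.exp (θ * Complex.I)))
      - (∫ θ in (-Real.pi)..Real.pi, Real.cos (θ - t) • f (ρ * Complex.exp (θ * Complex.I)))
    = ρ ^ 2 • ∫ θ in (-Real.pi)..Real.pi, Real.cos (θ - t) •
        Laplacian.laplacian f (ρ * Complex.exp (θ * Complex.I)) := by
  have hc := hf.continuous
  have hc1 := hf.continuous_fderiv two_ne_zero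
  have hc2 := hf.continuous_fderiv_fderiv
  have hL : ∫ θ in (-Real.pi)..Real.pi, Real.cos (θ - t) •
      Laplacian.laplacian f (ρ * Complex.exp (θ * Complex.I)) =
      ∫ θ in (-Real.pi)..Real.pi, (Real.cos (θ - t) •
        fderiv ℝ (fderiv ℝ f) (ρ * Complex.exp (θ * Complex.I))
          (Complex.exp (θ * Complex.I)) (Complex.exp (θ * Complex.I)) + Real.cos (θ - t) •
        fderiv ℝ (fderiv ℝ f) (ρ * Complex.exp (θ * Complex.I))
          (Complex.exp (θ * Complex.I) * Complex.I) (Complex.exp (θ * Complex.I) * Complex.I)) := by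
    refine intervalIntegral.integral_congr fun θ _ => ?_
    rw [laplacian_eq_fderiv_fderiv_rotated f _ θ, smul_add]
  rw [hL]
  refine Eq.trans ?_ (sub_zero _)
  rw [← integral_cos_smul_angular hf t ρ]
  simp only [← intervalIntegral.integral_smul]
  rw [← intervalIntegral.integral_add, ← intervalIntegral.integral_sub,
    ← intervalIntegral.integral_sub]
  · refine intervalIntegral.integral_congr fun θ _ => ?_
    module
  all_goals exact Continuous.intervalIntegrable (by fun_prop) _ _

/-- A second order solution of a Poisson inequality is controlled on circles: its first Fourier
mode deviates from that of its linear part by a quadratic term. -/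
theorem norm_fourierMode_sub_le (hf : ContDiff ℝ 2 f) (t : ℝ) {M R : ℝ} (hR : 0 < R)
    (hM : ∀ x, ‖x‖ ≤ R → ‖Laplacian.laplacian f x‖ ≤ M) :
    ‖(∫ θ in (-Real.pi)..Real.pi, Real.cos (θ - t) • f (R * Complex.exp (θ * Complex.I)))
      - (R * Real.pi) • fderiv ℝ f 0 (Complex.exp (t * Complex.I))‖
      ≤ 2 * Real.pi * M / 3 * R ^ 2 := by
  have hc := hf.continuous
  have hc1 := hf.continuous_fderiv two_ne_zero
  have hc2 := hf.continuous_fderiv_fderiv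
  have hM0 : 0 ≤ M := (norm_nonneg _).trans (hM 0 (by simpa using hR.le))
  set H : ℝ → ℂ := fun ρ => ∫ θ in (-Real.pi)..Real.pi,
    Real.cos (θ - t) • f (ρ * Complex.exp (θ * Complex.I)) with hHdef
  set H₁ : ℝ → ℂ := fun ρ => ∫ θ in (-Real.pi)..Real.pi, Real.cos (θ - t) •
    fderiv ℝ f (ρ * Complex.exp (θ * Complex.I)) (Complex.exp (θ * Complex.I)) with hH₁def
  set H₂ : ℝ → ℂ := fun ρ => ∫ θ in (-Real.pi)..Real.pi, Real.cos (θ - t) •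
    fderiv ℝ (fderiv ℝ f) (ρ * Complex.exp (θ * Complex.I))
      (Complex.exp (θ * Complex.I)) (Complex.exp (θ * Complex.I)) with hH₂def
  have hH : ∀ ρ, HasDerivAt H (H₁ ρ) ρ := by
    intro ρ
    refine hasDerivAt_intervalIntegral_of_continuous
      (F := fun ρ θ => Real.cos (θ - t) • f (ρ * Complex.exp (θ * Complex.I)))
      (F' := fun ρ θ => Real.cos (θ - t) •
        fderiv ℝ f (ρ * Complex.exp (θ * Complex.I)) (Complex.exp (θ * Complex.I)))
      (by unfold Function.uncurry; fun_prop) (by unfold Function.uncurry; fun_prop)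
      (fun x θ => ?_) _ _ ρ
    exact (hf.hasDerivAt_comp_of_two (hasDerivAt_ofReal_mul_const x _)).const_smul (Real.cos (θ - t))
  have hH₁ : ∀ ρ, HasDerivAt H₁ (H₂ ρ) ρ := by
    intro ρ
    refine hasDerivAt_intervalIntegral_of_continuous
      (F := fun ρ θ => Real.cos (θ - t) •
        fderiv ℝ f (ρ * Complex.exp (θ * Complex.I)) (Complex.exp (θ * Complex.I)))
      (F' := fun ρ θ => Real.cos (θ - t) •
        fderiv ℝ (fderiv ℝ f) (ρ * Complex.exp (θ * Complex.I))
        (Complex.exp (θ * Complex.I)) (Complex.exp (θ * Complex.I)))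
      (by unfold Function.uncurry; fun_prop) (by unfold Function.uncurry; fun_prop)
      (fun x θ => ?_) _ _ ρ
    have := (hf.hasDerivAt_fderiv_comp_apply (hasDerivAt_ofReal_mul_const x
      (Complex.exp (θ * Complex.I))) (hasDerivAt_const x (Complex.exp (θ * Complex.I))))
    simp only [map_zero, add_zero] at this
    exact this.const_smul (Real.cos (θ - t))
  have hode : ∀ ρ, 0 ≤ ρ → ρ ≤ R →
      ‖ρ ^ 2 • H₂ ρ + ρ • H₁ ρ - H ρ‖ ≤ 2 * Real.pi * M * ρ ^ 2 := by
    intro ρ h0 hρ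
    rw [fourierMode_ode hf t ρ, norm_smul, Real.norm_of_nonneg (by positivity)]
    have : ‖∫ θ in (-Real.pi)..Real.pi, Real.cos (θ - t) •
        Laplacian.laplacian f (ρ * Complex.exp (θ * Complex.I))‖
        ≤ M * |Real.pi - -Real.pi| := by
      refine intervalIntegral.norm_integral_le_of_norm_le_const fun θ _ => ?_
      rw [norm_smul, ← one_mul M]
      refine mul_le_mul (Real.abs_cos_le_one _) (hM _ ?_) (norm_nonneg _) zero_le_one
      rw [norm_mul, Complex.norm_exp_ofReal_mul_I, mul_one, Complex.norm_real,
        Real.norm_of_nonneg h0]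
      exact hρ
    rw [sub_neg_eq_add, abs_of_pos (by positivity)] at this
    nlinarith [mul_le_mul_of_nonneg_left this (sq_nonneg ρ)]
  -- The left side of the radial equation is the exact derivative of `W = ρ² H' - ρ H`, and `W(0) =
  -- 0`.
  have hW : ∀ ρ ∈ Icc 0 R, ‖ρ ^ 2 • H₁ ρ - ρ • H ρ‖ ≤ 2 * Real.pi * M / 3 * ρ ^ 3 := by
    have hd : ∀ ρ, HasDerivAt (fun ρ : ℝ => ρ ^ 2 • H₁ ρ - ρ • H ρ)
        (ρ ^ 2 • H₂ ρ + ρ • H₁ ρ - H ρ) ρ := by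
      intro ρ
      refine (((hasDerivAt_pow 2 ρ).smul (hH₁ ρ)).sub
        ((hasDerivAt_id ρ).smul (hH ρ))).congr_deriv ?_
      simp only [id, Nat.cast_ofNat]
      module
    refine image_norm_le_of_norm_deriv_right_le_deriv_boundary
      (B' := fun ρ => 2 * Real.pi * M * ρ ^ 2)
      (fun ρ _ => (hd ρ).continuousAt.continuousWithinAt)
      (fun ρ _ => (hd ρ).hasDerivWithinAt) (by simp) (fun ρ => ?_)
      (fun ρ hρ => hode ρ hρ.1 hρ.2.le)
    refine ((hasDerivAt_pow 3 ρ).const_mul (2 * Real.pi * M / 3)).congr_deriv ?_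
    push_cast
    ring
  have hH0 : H 0 = 0 := by
    simp only [hHdef, Complex.ofReal_zero, zero_mul]
    rw [intervalIntegral.integral_smul_const, integral_cos_sub_eq_zero, zero_smul]
  have hH₁0 : H₁ 0 = Real.pi • fderiv ℝ f 0 (Complex.exp (t * Complex.I)) := by
    simp only [hH₁def, Complex.ofReal_zero, zero_mul, ← map_smul]
    rw [ContinuousLinearMap.intervalIntegral_comp_comm _
      (Continuous.intervalIntegrable (by fun_prop) _ _), integral_cos_smul_exp, Complex.real_smul]
  -- `(H/ρ)' = W/ρ³` is bounded by `2πM/3`. The quotient is singular at 0, hence the segment `[ε,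
  -- R]`; `ε → 0` comes next, where `H(0) = 0` turns `H(ε)/ε` into a difference quotient.
  have hq : ∀ ε ∈ Ioc 0 R, ‖R⁻¹ • H R - ε⁻¹ • H ε‖ ≤ 2 * Real.pi * M / 3 * R := by
    intro ε hε
    have hb := norm_image_sub_le_of_norm_deriv_le_segment' (f := fun ρ : ℝ => ρ⁻¹ • H ρ)
      (f' := fun ρ => (ρ ^ 3)⁻¹ • (ρ ^ 2 • H₁ ρ - ρ • H ρ)) (a := ε) (b := R)
      (C := 2 * Real.pi * M / 3) (fun ρ hρ => ?_) (fun ρ hρ => ?_) R ⟨hε.2, le_rfl⟩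
    · refine hb.trans ?_
      have := hε.1.le
      gcongr
      linarith
    · have hρ0 : ρ ≠ 0 := (hε.1.trans_le hρ.1).ne'
      refine (((hasDerivAt_inv hρ0).smul (hH ρ)).congr_deriv ?_).hasDerivWithinAt
      have e1 : (ρ ^ 3)⁻¹ * ρ ^ 2 = ρ⁻¹ := by field_simp
      have e2 : (ρ ^ 3)⁻¹ * ρ = (ρ ^ 2)⁻¹ := by field_simp
      rw [smul_sub, smul_smul, smul_smul, e1, e2]
      module
    · have hρ0 : 0 < ρ := hε.1.trans_le hρ.1
      rw [norm_smul, Real.norm_of_nonneg (by positivity)]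
      have := hW ρ ⟨hρ0.le, hρ.2.le⟩
      rw [inv_mul_le_iff₀ (by positivity)]
      linarith
  have hlim : ‖R⁻¹ • H R - H₁ 0‖ ≤ 2 * Real.pi * M / 3 * R := by
    have h := (hH 0).tendsto_slope_zero_right
    simp only [zero_add, hH0, sub_zero] at h
    refine le_of_tendsto (h.const_sub (R⁻¹ • H R)).norm ?_
    filter_upwards [Ioc_mem_nhdsGT hR] with ε hε using hq ε hε
  have hfin : H R - (R * Real.pi) • fderiv ℝ f 0 (Complex.exp (t * Complex.I))
      = R • (R⁻¹ • H R - H₁ 0) := by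
    rw [hH₁0, smul_sub, smul_smul, smul_smul, mul_inv_cancel₀ hR.ne', one_smul]
  rw [hfin, norm_smul, Real.norm_of_nonneg hR.le]
  nlinarith

/-! ### From circles to disks. -/

/-- Integration over a disk centered at the origin in polar coordinates. -/
theorem setIntegral_ball_eq_polar {u : ℂ → ℝ} (hu : Continuous u) {s : ℝ} (hs : 0 ≤ s) :
    ∫ z in Metric.ball (0 : ℂ) s, u z =
      ∫ ρ in (0 : ℝ)..s, ρ * ∫ θ in (-Real.pi)..Real.pi, u (ρ * Complex.exp (θ * Complex.I)) := by
  have hpi : -Real.pi ≤ Real.pi := by linarith [Real.pi_pos]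
  rw [← integral_indicator Metric.isOpen_ball.measurableSet,
    ← Complex.integral_comp_polarCoord_symm, polarCoord_target]
  have hint : IntegrableOn (fun p : ℝ × ℝ => p.1 * u (p.1 * Complex.exp (p.2 * Complex.I)))
      (Ioo 0 s ×ˢ Ioo (-Real.pi) Real.pi) (volume.prod volume) := by
    refine IntegrableOn.mono_set (t := Icc 0 s ×ˢ Icc (-Real.pi) Real.pi) ?_
      (prod_mono Ioo_subset_Icc_self Ioo_subset_Icc_self)
    exact (Continuous.continuousOn (by fun_prop)).integrableOn_compact
      (isCompact_Icc.prod isCompact_Icc)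
  calc _ = ∫ p in Ioo 0 s ×ˢ Ioo (-Real.pi) Real.pi,
        p.1 * u (p.1 * Complex.exp (p.2 * Complex.I)) := by
        rw [← integral_indicator (measurableSet_Ioi.prod measurableSet_Ioo),
          ← integral_indicator (measurableSet_Ioo.prod measurableSet_Ioo)]
        congr 1
        ext p
        have hp : Complex.polarCoord.symm p = p.1 * Complex.exp (p.2 * Complex.I) := by
          rw [Complex.polarCoord_symm_apply, Complex.exp_mul_I]
          push_cast
          rfl
        have hn : ‖(p.1 : ℂ) * Complex.exp (p.2 * Complex.I)‖ = |p.1| := by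
          rw [norm_mul, Complex.norm_exp_ofReal_mul_I, mul_one, Complex.norm_real,
            Real.norm_eq_abs]
        simp only [indicator, hp, mem_ball_zero_iff, hn, mem_prod, mem_Ioi, mem_Ioo, smul_eq_mul]
        by_cases h1 : 0 < p.1
        · by_cases h2 : p.1 < s <;> simp [h1, h2, abs_of_pos h1]
        · simp [h1]
    _ = _ := by
        rw [Measure.volume_eq_prod, setIntegral_prod _ hint, intervalIntegral.integral_of_le hs,
          integral_Ioc_eq_integral_Ioo]
        refine setIntegral_congr_fun measurableSet_Ioo fun ρ _ => ?_
        simp only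
        rw [integral_const_mul, intervalIntegral.integral_of_le hpi, integral_Ioc_eq_integral_Ioo]

/-- Multiply the circle estimate by `ρ`, the polar Jacobian, and integrate over `[0, s]`: `ρ²` gives
`s³/3`, and the error `(2πM/3) ρ³` gives `πM s⁴/6`. -/
theorem norm_fderiv_zero_le_of_contDiff (hf : ContDiff ℝ 2 f) {M s : ℝ} (hs : 0 < s)
    (hM : ∀ x, ‖x‖ ≤ s → ‖Laplacian.laplacian f x‖ ≤ M) :
    Real.pi * s ^ 3 / 3 * ‖fderiv ℝ f 0‖ ≤
      (∫ z in Metric.ball (0 : ℂ) s, ‖f z - f 0‖) + Real.pi * M * s ^ 4 / 6 := by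
  have hc := hf.continuous
  have hM0 : 0 ≤ M := (norm_nonneg _).trans (hM 0 (by simpa using hs.le))
  have hpi := Real.pi_pos
  have key : ∀ t : ℝ, Real.pi * s ^ 3 / 3 * ‖fderiv ℝ f 0 (Complex.exp (t * Complex.I))‖ ≤
      (∫ z in Metric.ball (0 : ℂ) s, ‖f z - f 0‖) + Real.pi * M * s ^ 4 / 6 := by
    intro t
    set X := ‖fderiv ℝ f 0 (Complex.exp (t * Complex.I))‖
    have hcont : Continuous (fun ρ : ℝ => ∫ θ in (-Real.pi)..Real.pi,
        ‖f (ρ * Complex.exp (θ * Complex.I)) - f 0‖) :=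
      intervalIntegral.continuous_parametric_intervalIntegral_of_continuous'
        (by unfold Function.uncurry; fun_prop) _ _
    have hpt : ∀ ρ ∈ Icc 0 s, Real.pi * X * ρ ^ 2 ≤
        ρ * (∫ θ in (-Real.pi)..Real.pi, ‖f (ρ * Complex.exp (θ * Complex.I)) - f 0‖)
          + 2 * Real.pi * M / 3 * ρ ^ 3 := by
      intro ρ hρ
      rcases hρ.1.eq_or_lt with rfl | h0
      · simp
      have h1 := norm_fourierMode_sub_le hf t h0 (fun x hx => hM x (hx.trans hρ.2))
      have h2 : ‖∫ θ in (-Real.pi)..Real.pi,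
          Real.cos (θ - t) • f (ρ * Complex.exp (θ * Complex.I))‖ ≤
          ∫ θ in (-Real.pi)..Real.pi, ‖f (ρ * Complex.exp (θ * Complex.I)) - f 0‖ := by
        -- The cosine has mean zero over the circle, so the constant `f 0` may be subtracted.
        have e : ∫ θ in (-Real.pi)..Real.pi,
            Real.cos (θ - t) • f (ρ * Complex.exp (θ * Complex.I))
            = ∫ θ in (-Real.pi)..Real.pi,
            Real.cos (θ - t) • (f (ρ * Complex.exp (θ * Complex.I)) - f 0) := by
          simp only [smul_sub]
          rw [intervalIntegral.integral_sub, intervalIntegral.integral_smul_const,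
            integral_cos_sub_eq_zero, zero_smul, sub_zero]
          all_goals exact Continuous.intervalIntegrable (by fun_prop) _ _
        rw [e]
        refine intervalIntegral.norm_integral_le_of_norm_le (by linarith)
          (Eventually.of_forall fun θ _ => ?_) (Continuous.intervalIntegrable (by fun_prop) _ _)
        rw [norm_smul]
        exact mul_le_of_le_one_left (norm_nonneg _) (Real.abs_cos_le_one _)
      have h3 : ρ * Real.pi * X = ‖(ρ * Real.pi) • fderiv ℝ f 0 (Complex.exp (t * Complex.I))‖ := by
        rw [norm_smul, Real.norm_of_nonneg (by positivity)]
      have h4 := norm_sub_norm_le ((ρ * Real.pi) • fderiv ℝ f 0 (Complex.exp (t * Complex.I)))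
        (∫ θ in (-Real.pi)..Real.pi, Real.cos (θ - t) • f (ρ * Complex.exp (θ * Complex.I)))
      rw [norm_sub_rev, ← h3] at h4
      nlinarith
    have hI := intervalIntegral.integral_mono_on (μ := volume) hs.le
      (Continuous.intervalIntegrable (by fun_prop) _ _)
      (Continuous.intervalIntegrable (by fun_prop) _ _) hpt
    rw [intervalIntegral.integral_const_mul, intervalIntegral.integral_add
      (Continuous.intervalIntegrable (by fun_prop) _ _)
      (Continuous.intervalIntegrable (by fun_prop) _ _), intervalIntegral.integral_const_mul,
      integral_pow, integral_pow,
      ← setIntegral_ball_eq_polar (u := fun z => ‖f z - f 0‖) (by fun_prop) hs.le] at hI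
    norm_num at hI
    linarith
  have hA : 0 < Real.pi * s ^ 3 / 3 := by positivity
  rw [← le_div_iff₀' hA]
  have hnn : 0 ≤ ((∫ z in Metric.ball (0 : ℂ) s, ‖f z - f 0‖) + Real.pi * M * s ^ 4 / 6) /
      (Real.pi * s ^ 3 / 3) := by positivity
  -- Every unit vector is `e^{it}` with `t` its argument, so the directional bounds give the
  -- operator norm.
  refine ContinuousLinearMap.opNorm_le_of_unit_norm hnn fun v hv => ?_
  rw [le_div_iff₀' hA]
  have := key v.arg
  rwa [show Complex.exp (v.arg * Complex.I) = v by
    simpa [hv] using Complex.norm_mul_exp_arg_mul_I v] at this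

end Radial

/-! ### Transfer to an arbitrary disk. -/

theorem laplacian_comp_add_left (f : ℂ → ℂ) (a x : ℂ) :
    Laplacian.laplacian (fun y => f (a + y)) x = Laplacian.laplacian f (a + x) := by
  simp only [InnerProductSpace.laplacian_eq_iteratedFDeriv_complexPlane,
    iteratedFDeriv_comp_add_left]

theorem setIntegral_ball_comp_add_left (u : ℂ → ℝ) (a : ℂ) (s : ℝ) :
    ∫ x in Metric.ball (0 : ℂ) s, u (a + x) = ∫ x in Metric.ball a s, u x := by
  rw [← integral_indicator Metric.isOpen_ball.measurableSet,
    ← integral_indicator Metric.isOpen_ball.measurableSet,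
    ← integral_add_left_eq_self ((Metric.ball a s).indicator u) a]
  congr 1
  ext x
  simp only [indicator, Metric.mem_ball, dist_zero_right, dist_self_add_left]

/-- A function that is `C²` on a ball agrees near any smaller concentric closed ball with a
function that is `C²` on the plane. -/
theorem exists_contDiff_eventuallyEq_of_contDiffOn_ball {f : ℂ → ℂ} {z : ℂ} {s R : ℝ}
    (hs : 0 < s) (hsR : s < R) (hf : ContDiffOn ℝ 2 f (Metric.ball z R)) :
    ∃ F : ℂ → ℂ, ContDiff ℝ 2 F ∧ ∀ x ∈ Metric.closedBall z s, F =ᶠ[𝓝 x] f := by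
  -- The inner radius exceeds `s`, so the cutoff is 1 near each point of the closed ball; the outer
  -- one is below `R`, so the product extends by zero.
  let χ : ContDiffBump z := ⟨(2 * s + R) / 3, (s + 2 * R) / 3, by linarith, by linarith⟩
  refine ⟨fun x => χ x • f x, contDiff_iff_contDiffAt.2 fun x => ?_, fun x hx => ?_⟩
  · by_cases hx : x ∈ Metric.ball z R
    · exact χ.contDiff.contDiffAt.smul (hf.contDiffAt (Metric.isOpen_ball.mem_nhds hx))
    · have hx' : x ∉ tsupport χ := by
        rw [χ.tsupport_eq]
        intro h
        rw [Metric.mem_closedBall] at h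
        rw [Metric.mem_ball] at hx
        have : χ.rOut = (s + 2 * R) / 3 := rfl
        linarith
      have h0 : (fun x => χ x • f x) =ᶠ[𝓝 x] fun _ => 0 := by
        filter_upwards [(notMem_tsupport_iff_eventuallyEq.1 hx')] with y hy
        simp [hy]
      exact contDiffAt_const.congr_of_eventuallyEq h0
  · have hx' : x ∈ Metric.ball z χ.rIn := by
      rw [Metric.mem_closedBall] at hx
      rw [Metric.mem_ball]
      have : χ.rIn = (2 * s + R) / 3 := rfl
      linarith
    filter_upwards [χ.eventuallyEq_one_of_mem_ball hx'] with y hy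
    simp [hy]

/-- Interior gradient estimate for Poisson's equation. -/
theorem norm_fderiv_le_of_laplacian_le {f : ℂ → ℂ} {z : ℂ} {s R M : ℝ}
    (hs : 0 < s) (hsR : s < R) (hf : ContDiffOn ℝ 2 f (Metric.ball z R))
    (hM : ∀ x ∈ Metric.closedBall z s, ‖Laplacian.laplacian f x‖ ≤ M) :
    Real.pi * s ^ 3 / 3 * ‖fderiv ℝ f z‖ ≤
      (∫ ζ in Metric.ball z s, ‖f ζ - f z‖) + Real.pi * M * s ^ 4 / 6 := by
  obtain ⟨F, hF, hFf⟩ := exists_contDiff_eventuallyEq_of_contDiffOn_ball hs hsR hf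
  have hz := hFf z (Metric.mem_closedBall_self hs.le)
  have hmain := norm_fderiv_zero_le_of_contDiff (f := fun x => F (z + x)) (M := M)
    (hF.comp (contDiff_const.add contDiff_id)) hs (fun x hx => by
      have hx' : z + x ∈ Metric.closedBall z s := by simpa using hx
      rw [laplacian_comp_add_left, (InnerProductSpace.laplacian_congr_nhds (hFf _ hx')).eq_of_nhds]
      exact hM _ hx')
  rw [fderiv_comp_add_left, setIntegral_ball_comp_add_left (fun x => ‖F x - F (z + 0)‖)] at hmain
  simp only [add_zero] at hmain
  rw [hz.fderiv_eq, hz.eq_of_nhds] at hmain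
  rwa [setIntegral_congr_fun (g := fun x => ‖f x - f z‖) Metric.isOpen_ball.measurableSet
    (fun x hx => by
      simp only [(hFf x (Metric.ball_subset_closedBall hx)).eq_of_nhds])] at hmain

/-! ### Mean oscillation from a power bound on the derivative. -/

theorem integrableOn_sub_rpow_Ioo {r γ : ℝ} (hr : 0 < r) (hγ : γ < 1) :
    IntegrableOn (fun y : ℝ => (r - y) ^ (-γ)) (Ioo 0 r) := by
  have h := (intervalIntegral.intervalIntegrable_rpow' (a := 0) (b := r) (r := -γ)
    (by linarith)).comp_sub_left r
  simp only [sub_zero, sub_self] at h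
  exact (intervalIntegrable_iff_integrableOn_Ioo_of_le hr.le).1 h.symm

theorem setIntegral_sub_rpow_Ioo {r γ : ℝ} (hr : 0 < r) (hγ : γ < 1) :
    ∫ y in Ioo 0 r, (r - y) ^ (-γ) = r ^ (1 - γ) / (1 - γ) := by
  rw [← integral_Ioc_eq_integral_Ioo, ← intervalIntegral.integral_of_le hr.le,
    intervalIntegral.integral_comp_sub_left (fun y => y ^ (-γ)), sub_zero, sub_self,
    integral_rpow (Or.inl (by linarith)), Real.zero_rpow (by linarith), sub_zero, neg_add_eq_sub]

theorem integrableOn_ball_sub_norm_rpow {r γ : ℝ} (hr : 0 < r) (hγ : γ < 1) :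
    IntegrableOn (fun x : ℂ => (r - ‖x‖) ^ (-γ)) (Metric.ball 0 r) := by
  refine (integrableOn_fun_norm_addHaar (E := ℂ) volume (f := fun y => (r - y) ^ (-γ))).2 ?_
  rw [Complex.finrank_real_complex]
  refine Integrable.mono' ((integrableOn_sub_rpow_Ioo hr hγ).const_mul r)
    (Measurable.aestronglyMeasurable (by fun_prop)) ?_
  filter_upwards [self_mem_ae_restrict measurableSet_Ioo] with y hy
  have := Real.rpow_nonneg (sub_nonneg.2 hy.2.le) (-γ)
  rw [norm_smul, Real.norm_of_nonneg this, Real.norm_of_nonneg (by have := hy.1; positivity)]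
  have := hy.2.le
  gcongr
  simpa using this

/-- In polar coordinates the Jacobian `y` is bounded by `r`, leaving the integral of a pure power.
-/
theorem setIntegral_ball_sub_norm_rpow_le {r γ : ℝ} (hr : 0 < r) (hγ : γ < 1) :
    ∫ x in Metric.ball (0 : ℂ) r, (r - ‖x‖) ^ (-γ) ≤ 2 * Real.pi * r ^ (2 - γ) / (1 - γ) := by
  have h1 : ∫ x in Metric.ball (0 : ℂ) r, (r - ‖x‖) ^ (-γ)
      = 2 * Real.pi * ∫ y in Ioo 0 r, y * (r - y) ^ (-γ) := by
    rw [← integral_indicator Metric.isOpen_ball.measurableSet]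
    have := integral_fun_norm_addHaar (E := ℂ) volume
      (fun y => (Iio r).indicator (fun y => (r - y) ^ (-γ)) y)
    convert this using 1
    · congr 1
      ext x
      simp [indicator]
    · rw [Complex.finrank_real_complex, ← Ioi_inter_Iio,
        ← setIntegral_indicator measurableSet_Iio]
      simp [Measure.real, Complex.volume_ball, indicator, mul_assoc]
  have h2 : ∫ y in Ioo 0 r, y * (r - y) ^ (-γ) ≤ r * (r ^ (1 - γ) / (1 - γ)) := by
    rw [← setIntegral_sub_rpow_Ioo hr hγ, ← integral_const_mul]
    refine integral_mono_of_nonneg ?_ ((integrableOn_sub_rpow_Ioo hr hγ).const_mul r) ?_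
    · filter_upwards [self_mem_ae_restrict measurableSet_Ioo] with y hy
      exact mul_nonneg hy.1.le (Real.rpow_nonneg (sub_nonneg.2 hy.2.le) _)
    · filter_upwards [self_mem_ae_restrict measurableSet_Ioo] with y hy
      exact mul_le_mul_of_nonneg_right hy.2.le (Real.rpow_nonneg (sub_nonneg.2 hy.2.le) _)
  rw [h1, show (2 : ℝ) - γ = 1 + (1 - γ) by ring, Real.rpow_add hr, Real.rpow_one]
  calc _ ≤ 2 * Real.pi * (r * (r ^ (1 - γ) / (1 - γ))) := by gcongr
    _ = _ := by ring

/-- Growth of a function whose derivative blows up at most like a power at the boundary of a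
ball. -/
theorem norm_sub_center_le_of_norm_fderiv_le {f : ℂ → ℂ} {z : ℂ} {r K β : ℝ} (hβ : 1 < β)
    (hf : DifferentiableOn ℝ f (Metric.ball z r)) (hK : 0 ≤ K)
    (hbd : ∀ w ∈ Metric.ball z r, ‖fderiv ℝ f w‖ ≤ K * (r - ‖w - z‖) ^ (-β))
    {ζ : ℂ} (hζ : ζ ∈ Metric.ball z r) :
    ‖f ζ - f z‖ ≤ K / (β - 1) * (r - ‖ζ - z‖) ^ (-(β - 1)) := by
  rw [mem_ball_iff_norm] at hζ
  set ρ := ‖ζ - z‖ with hρ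
  have hρ0 : 0 ≤ ρ := norm_nonneg _
  have hβ' : 0 < β - 1 := by linarith
  have hpos : ∀ τ ∈ Icc (0 : ℝ) 1, 0 < r - τ * ρ := fun τ hτ => by
    nlinarith [hτ.1, hτ.2]
  have hnorm : ∀ τ ∈ Icc (0 : ℝ) 1, ‖z + (τ : ℂ) * (ζ - z) - z‖ = τ * ρ := fun τ hτ => by
    rw [add_sub_cancel_left, norm_mul, Complex.norm_real, Real.norm_of_nonneg hτ.1]
  have hmem : ∀ τ ∈ Icc (0 : ℝ) 1, z + (τ : ℂ) * (ζ - z) ∈ Metric.ball z r := fun τ hτ => by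
    rw [mem_ball_iff_norm, hnorm τ hτ]
    linarith [hpos τ hτ]
  have hd : ∀ τ ∈ Icc (0 : ℝ) 1, HasDerivAt (fun τ : ℝ => f (z + (τ : ℂ) * (ζ - z)) - f z)
      (fderiv ℝ f (z + (τ : ℂ) * (ζ - z)) (ζ - z)) τ := fun τ hτ =>
    (((hf.differentiableAt (Metric.isOpen_ball.mem_nhds (hmem τ hτ))).hasFDerivAt).comp_hasDerivAt τ
      ((hasDerivAt_ofReal_mul_const τ (ζ - z)).const_add z)).sub_const _
  -- The claimed bound, evaluated along the segment from `z` to `ζ`, is a barrier: its derivative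
  -- equals the assumed bound on the speed.
  have hB : ∀ τ ∈ Icc (0 : ℝ) 1,
      HasDerivAt (fun τ : ℝ => K / (β - 1) * (r - τ * ρ) ^ (-(β - 1)))
        (K * (r - τ * ρ) ^ (-β) * ρ) τ := fun τ hτ => by
    have h1 : HasDerivAt (fun τ : ℝ => r - τ * ρ) (-ρ) τ := by
      simpa using ((hasDerivAt_id τ).mul_const ρ).const_sub r
    refine ((h1.rpow_const (p := -(β - 1)) (Or.inl (hpos τ hτ).ne')).const_mul
      (K / (β - 1))).congr_deriv ?_
    rw [show -(β - 1) - 1 = -β by ring]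
    field_simp
  have h := image_norm_le_of_norm_deriv_right_le_deriv_boundary'
    (fun τ hτ => (hd τ hτ).continuousAt.continuousWithinAt)
    (fun τ hτ => (hd τ (Ico_subset_Icc_self hτ)).hasDerivWithinAt)
    (by
      simp only [Complex.ofReal_zero, zero_mul, add_zero, sub_self, norm_zero, sub_zero]
      have := Real.rpow_nonneg (hρ0.trans hζ.le) (-(β - 1))
      positivity)
    (fun τ hτ => (hB τ hτ).continuousAt.continuousWithinAt)
    (fun τ hτ => (hB τ (Ico_subset_Icc_self hτ)).hasDerivWithinAt)
    (fun τ hτ => by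
      have hτ' := Ico_subset_Icc_self hτ
      refine (ContinuousLinearMap.le_opNorm _ _).trans ?_
      have := hbd _ (hmem τ hτ')
      rw [hnorm τ hτ'] at this
      exact mul_le_mul_of_nonneg_right this hρ0) (right_mem_Icc.2 zero_le_one)
  simpa using h

/-- The radial growth has exponent `-(β-1) > -1`, so it is integrable up to the bounding circle.
Integration gives `r^(3-β)`, and dividing by the area leaves `r^(1-β)`. -/
theorem setAverage_norm_sub_center_le {f : ℂ → ℂ} {z : ℂ} {r K β : ℝ} (hr : 0 < r) (hβ : 1 < β)
    (hβ₂ : β < 2) (hf : DifferentiableOn ℝ f (Metric.ball z r)) (hK : 0 ≤ K)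
    (hbd : ∀ w ∈ Metric.ball z r, ‖fderiv ℝ f w‖ ≤ K * (r - ‖w - z‖) ^ (-β)) :
    1 / volume.real (Metric.ball z r) * ∫ ζ in Metric.ball z r, ‖f ζ - f z‖ ≤
      2 / ((β - 1) * (2 - β)) * (K * r ^ (1 - β)) := by
  have hβ' : 0 < β - 1 := by linarith
  have hβ₂' : 0 < 2 - β := by linarith
  have hvol : volume.real (Metric.ball z r) = Real.pi * r ^ 2 := by
    simp [Measure.real, Complex.volume_ball, hr.le, mul_comm]
  have hI : ∫ ζ in Metric.ball z r, ‖f ζ - f z‖ ≤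
      K / (β - 1) * (2 * Real.pi * r ^ (3 - β) / (2 - β)) := by
    rw [← setIntegral_ball_comp_add_left (fun ζ => ‖f ζ - f z‖)]
    have h1 := setIntegral_ball_sub_norm_rpow_le (γ := β - 1) hr (by linarith)
    rw [show 2 - (β - 1) = 3 - β by ring, show 1 - (β - 1) = 2 - β by ring] at h1
    refine le_trans ?_ (mul_le_mul_of_nonneg_left h1 (by positivity))
    rw [← integral_const_mul]
    refine integral_mono_of_nonneg (Eventually.of_forall fun x => norm_nonneg _)
      ((integrableOn_ball_sub_norm_rpow hr (by linarith)).const_mul _) ?_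
    filter_upwards [self_mem_ae_restrict Metric.isOpen_ball.measurableSet] with x hx
    have hx' : z + x ∈ Metric.ball z r := by simpa using hx
    simpa using norm_sub_center_le_of_norm_fderiv_le hβ hf hK hbd hx'
  rw [hvol]
  have hp : r ^ (3 - β) = r ^ 2 * r ^ (1 - β) := by
    rw [← Real.rpow_natCast, ← Real.rpow_add hr]
    congr 1
    push_cast
    ring
  calc _ ≤ 1 / (Real.pi * r ^ 2) * (K / (β - 1) * (2 * Real.pi * r ^ (3 - β) / (2 - β))) := by
        gcongr
    _ = _ := by
        rw [hp]
        have := Real.pi_pos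
        field_simp

/-! ### Majorants. -/

namespace IsMajorant

variable {ω : ℝ → ℝ}

theorem nonneg (hω : IsMajorant ω) {t : ℝ} (ht : 0 ≤ t) : 0 ≤ ω t := by
  rw [← hω.map_zero]
  exact hω.monotoneOn self_mem_Ici ht ht

/-- This is `ω(t)/t ≤ ω(ct)/(ct)` cleared of denominators; both implications use the decay of
`ω(t)/t` in this form. -/
theorem mul_apply_le (hω : IsMajorant ω) {c t : ℝ} (hc₀ : 0 ≤ c) (hc : c ≤ 1) (ht : 0 ≤ t) :
    c * ω t ≤ ω (c * t) := by
  rcases hc₀.eq_or_lt with rfl | hc₀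
  · simp [hω.map_zero]
  rcases ht.eq_or_lt with rfl | ht
  · simp [hω.map_zero]
  have h := hω.antitoneOn_div (mem_Ioi.2 (mul_pos hc₀ ht)) (mem_Ioi.2 ht)
    (mul_le_of_le_one_left ht.le hc)
  simp only at h
  rw [div_le_div_iff₀ ht (mul_pos hc₀ ht)] at h
  nlinarith

/-- Monotonicity propagates a nonzero value to the right, and `mul_apply_le` propagates it to the
left. -/
theorem pos (hω : IsMajorant ω) (hω₀ : ∃ t : ℝ, 0 ≤ t ∧ ω t ≠ 0) {t : ℝ} (ht : 0 < t) :
    0 < ω t := by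
  obtain ⟨t₀, ht₀, hne⟩ := hω₀
  have h₀ : 0 < ω t₀ := (hω.nonneg ht₀).lt_of_ne' hne
  rcases le_total t₀ t with h | h
  · exact h₀.trans_le (hω.monotoneOn ht₀ ht.le h)
  · have ht₀' := ht.trans_le h
    have := hω.mul_apply_le (c := t / t₀) (by positivity) ((div_le_one ht₀').2 h) ht₀
    rw [div_mul_cancel₀ _ ht₀'.ne'] at this
    exact lt_of_lt_of_le (by positivity) this

end IsMajorant

/-! ### Geometry of the unit disk. -/

theorem norm_lt_one_of_mem_unitDisk {z : ℂ} (hz : z ∈ unitDisk) : ‖z‖ < 1 :=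
  mem_ball_zero_iff.1 hz

theorem frontier_unitDisk : frontier unitDisk = Metric.sphere 0 1 :=
  frontier_ball 0 one_ne_zero

theorem closure_unitDisk : closure unitDisk = Metric.closedBall 0 1 :=
  closure_ball 0 one_ne_zero

theorem distBdry_eq_one_sub_norm {z : ℂ} (hz : z ∈ unitDisk) : distBdry z = 1 - ‖z‖ := by
  have hz' := norm_lt_one_of_mem_unitDisk hz
  rw [distBdry, frontier_unitDisk]
  refine le_antisymm ?_ ?_
  · have hmem : Complex.exp (z.arg * Complex.I) ∈ Metric.sphere (0 : ℂ) 1 := by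
      simp
    refine (Metric.infDist_le_dist_of_mem hmem).trans_eq ?_
    rw [dist_eq_norm]
    nth_rw 1 [← Complex.norm_mul_exp_arg_mul_I z]
    rw [← sub_one_mul, norm_mul, Complex.norm_exp_ofReal_mul_I, mul_one, ← Complex.ofReal_one,
      ← Complex.ofReal_sub, Complex.norm_real, Real.norm_of_nonpos (by linarith), neg_sub]
  · refine (Metric.le_infDist ⟨1, by simp⟩).2 fun y hy => ?_
    rw [dist_eq_norm, norm_sub_rev]
    have := norm_sub_norm_le y z
    rwa [mem_sphere_zero_iff_norm.1 hy] at this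

theorem ball_distBdry_subset_unitDisk {z : ℂ} (hz : z ∈ unitDisk) {r : ℝ} (hr : r ≤ distBdry z) :
    Metric.ball z r ⊆ unitDisk := by
  rw [distBdry_eq_one_sub_norm hz] at hr
  refine Metric.ball_subset_ball' ?_
  rw [dist_zero_right]
  linarith

/-! ### The two implications. -/

theorem IsBlochType.setAverage_le {f : ℂ → ℂ} {α : ℝ} {ω : ℝ → ℝ} (hf : IsBlochType ω α f)
    (hα₁ : 1 ≤ α) (hα₂ : α < 2) (hω : IsMajorant ω) (hω₀ : ∃ t : ℝ, 0 ≤ t ∧ ω t ≠ 0) :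
    ∃ C : ℝ, 0 < C ∧ ∀ z ∈ unitDisk, ∀ r ∈ Set.Ioc 0 (distBdry z),
      1 / volume.real (Metric.ball z r) *
        ∫ ζ in Metric.ball z r, ‖f ζ - f z‖ ≤ C * (r / ω (r ^ α)) := by
  obtain ⟨A₀, hA₀⟩ := hf.bddAbove
  set A := max A₀ 1
  have hA : 0 < A := lt_max_of_lt_right one_pos
  have hA' : ∀ w ∈ unitDisk, ‖fderiv ℝ f w‖ * ω (distBdry w ^ α) ≤ A := fun w hw =>
    (hA₀ (mem_image_of_mem _ hw)).trans (le_max_left _ _)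
  -- Enlarging the exponent keeps it above 1 even when `α = 1`, where integrating `q^(-α)` would
  -- produce a logarithm.
  obtain ⟨β, hαβ, hβ₂⟩ := exists_between hα₂
  have hβ : 1 < β := hα₁.trans_lt hαβ
  refine ⟨2 / ((β - 1) * (2 - β)) * A, ?_, fun z hz r hr => ?_⟩
  · have : 0 < (β - 1) * (2 - β) := mul_pos (by linarith) (by linarith)
    positivity
  have hr₀ : 0 < r := hr.1
  have hsub := ball_distBdry_subset_unitDisk hz hr.2
  have hωr : 0 < ω (r ^ α) := hω.pos hω₀ (by positivity)
  have h := setAverage_norm_sub_center_le (f := f) (z := z) (K := A * r ^ β / ω (r ^ α)) hr₀ hβ hβ₂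
    ((hf.contDiffOn.differentiableOn one_ne_zero).mono hsub) (by positivity) (fun w hw => ?_)
  · refine h.trans_eq ?_
    have : r ^ β * r ^ (1 - β) = r := by
      rw [← Real.rpow_add hr₀, add_sub_cancel, Real.rpow_one]
    rw [show A * r ^ β / ω (r ^ α) * r ^ (1 - β)
      = A * (r ^ β * r ^ (1 - β)) / ω (r ^ α) by ring, this]
    ring
  · have hwD := hsub hw
    rw [mem_ball_iff_norm] at hw
    set q := r - ‖w - z‖ with hq
    have hq₀ : 0 < q := by linarith
    have hqr : q ≤ r := by linarith [norm_nonneg (w - z)]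
    have hqd : q ≤ distBdry w := by
      have h1 := hr.2
      rw [distBdry_eq_one_sub_norm hz] at h1
      rw [distBdry_eq_one_sub_norm hwD]
      linarith [norm_sub_norm_le w z]
    have hratio : (q / r) ^ β ≤ (q / r) ^ α :=
      Real.rpow_le_rpow_of_exponent_ge (by positivity) ((div_le_one hr₀).2 hqr) hαβ.le
    have hlow : (q / r) ^ β * ω (r ^ α) ≤ ω (distBdry w ^ α) := by
      calc (q / r) ^ β * ω (r ^ α) ≤ (q / r) ^ α * ω (r ^ α) := by gcongr
        _ ≤ ω ((q / r) ^ α * r ^ α) := hω.mul_apply_le (by positivity)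
            (Real.rpow_le_one (by positivity) ((div_le_one hr₀).2 hqr) (by linarith))
            (by positivity)
        _ = ω (q ^ α) := by
            rw [← Real.mul_rpow (by positivity) hr₀.le, div_mul_cancel₀ _ hr₀.ne']
        _ ≤ ω (distBdry w ^ α) := hω.monotoneOn (mem_Ici.2 (by positivity))
            (mem_Ici.2 (Real.rpow_nonneg (hq₀.le.trans hqd) _))
            (Real.rpow_le_rpow hq₀.le hqd (by linarith))
    have h1 : ‖fderiv ℝ f w‖ * ((q / r) ^ β * ω (r ^ α)) ≤ A :=
      (mul_le_mul_of_nonneg_left hlow (norm_nonneg _)).trans (hA' w hwD)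
    rw [← le_div_iff₀ (by positivity)] at h1
    refine h1.trans_eq ?_
    rw [Real.div_rpow hq₀.le hr₀.le, Real.rpow_neg hq₀.le]
    field_simp

theorem IsPoissonSolution.isBlochType {f g : ℂ → ℂ} (hg : ContinuousOn g (closure unitDisk))
    (hf : IsPoissonSolution g unitDisk f) {α : ℝ} (hα₁ : 1 ≤ α) (hα₂ : α < 2)
    {ω : ℝ → ℝ} (hω : IsMajorant ω) (hω₀ : ∃ t : ℝ, 0 ≤ t ∧ ω t ≠ 0) {C : ℝ}
    (h : ∀ z ∈ unitDisk, ∀ r ∈ Set.Ioc 0 (distBdry z),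
      1 / volume.real (Metric.ball z r) *
        ∫ ζ in Metric.ball z r, ‖f ζ - f z‖ ≤ C * (r / ω (r ^ α))) :
    IsBlochType ω α f := by
  refine ⟨hf.contDiffOn.of_le (by norm_num), ?_⟩
  obtain ⟨M, hM⟩ := IsCompact.exists_bound_of_continuousOn
    (closure_unitDisk ▸ isCompact_closedBall (0 : ℂ) 1) hg
  -- Four times the bound `3C + (M s / 2) ω(s^α)` of `hX`, with `s ≤ 1`; the factor 4 comes from
  -- passing from `s` to `d(z) = 2s`.
  refine ⟨12 * C + 2 * M * ω 1, ?_⟩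
  rintro _ ⟨z, hz, rfl⟩
  have hM0 : 0 ≤ M := (norm_nonneg _).trans (hM z (subset_closure hz))
  have hd := distBdry_eq_one_sub_norm hz
  have hz' := norm_lt_one_of_mem_unitDisk hz
  -- Half the distance keeps the closed disk of radius `s` inside the open one of radius `2s`, where
  -- `f` is `C²`.
  obtain ⟨s, hs⟩ : ∃ s, distBdry z = 2 * s := ⟨distBdry z / 2, by ring⟩
  have hs₀ : 0 < s := by linarith
  have hs₁ : s ≤ 1 := by linarith [norm_nonneg z]
  have hωs : 0 < ω (s ^ α) := hω.pos hω₀ (by positivity)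
  have hmean := h z hz s ⟨hs₀, by linarith⟩
  have hvol : volume.real (Metric.ball z s) = Real.pi * s ^ 2 := by
    simp [Measure.real, Complex.volume_ball, hs₀.le, mul_comm]
  have hgrad := norm_fderiv_le_of_laplacian_le (f := f) (z := z) (M := M) hs₀
    (show s < 2 * s by linarith)
    (hf.contDiffOn.mono (ball_distBdry_subset_unitDisk hz hs.ge)) (fun x hx => by
      have hx' : x ∈ unitDisk := ball_distBdry_subset_unitDisk hz hs.ge
        (Metric.closedBall_subset_ball (by linarith) hx)
      rw [hf.laplacian_eq x hx']
      exact hM x (subset_closure hx'))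
  have hpi := Real.pi_pos
  rw [hvol, one_div, inv_mul_le_iff₀ (by positivity)] at hmean
  set X := ‖fderiv ℝ f z‖
  have hX : X * ω (s ^ α) ≤ 3 * C + M * s / 2 * ω (s ^ α) := by
    have h1 : Real.pi * s ^ 3 / 3 * X ≤
        Real.pi * s ^ 3 / 3 * (3 * C / ω (s ^ α) + M * s / 2) := by
      refine hgrad.trans ((add_le_add_left hmean _).trans_eq ?_)
      field_simp
      ring
    have h2 := mul_le_mul_of_nonneg_right (le_of_mul_le_mul_left h1 (by positivity)) hωs.le
    rwa [add_mul, div_mul_cancel₀ _ hωs.ne'] at h2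
  -- Doubling: `2^α ≤ 4` since `α < 2`, and `ω(4x) ≤ 4 ω(x)` by `mul_apply_le` with `c = 1/4`.
  have hω4 : ω (distBdry z ^ α) ≤ 4 * ω (s ^ α) := by
    have h1 : (2 : ℝ) ^ α ≤ 4 := by
      refine (Real.rpow_le_rpow_of_exponent_le one_le_two hα₂.le).trans_eq ?_
      norm_num
    have h2 := hω.mul_apply_le (c := (1 / 4 : ℝ)) (t := 4 * s ^ α) (by norm_num) (by norm_num)
      (by positivity)
    rw [show 1 / 4 * (4 * s ^ α) = s ^ α by ring] at h2
    have h3 : ω (distBdry z ^ α) ≤ ω (4 * s ^ α) := by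
      rw [hs, Real.mul_rpow zero_le_two hs₀.le]
      refine hω.monotoneOn (mem_Ici.2 (by positivity)) (mem_Ici.2 (by positivity)) ?_
      gcongr
    linarith
  have hω1 : ω (s ^ α) ≤ ω 1 := hω.monotoneOn (mem_Ici.2 (by positivity))
    (mem_Ici.2 zero_le_one) (Real.rpow_le_one hs₀.le hs₁ (by linarith))
  have h5 : M * s * ω (s ^ α) ≤ M * ω 1 := by
    have : M * s ≤ M := mul_le_of_le_one_right hM0 hs₁
    gcongr
  have h6 : X * ω (distBdry z ^ α) ≤ X * (4 * ω (s ^ α)) :=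
    mul_le_mul_of_nonneg_left hω4 (norm_nonneg _)
  simp only
  linarith

theorem theorem2 (f g : ℂ → ℂ) (hg : ContinuousOn g (closure unitDisk))
    (hf : IsPoissonSolution g unitDisk f) (α : ℝ) (hα₁ : 1 ≤ α) (hα₂ : α < 2)
    (ω : ℝ → ℝ) (hω : IsMajorant ω) (hω₀ : ∃ t : ℝ, 0 ≤ t ∧ ω t ≠ 0) :
    IsBlochType ω α f ↔
      ∃ C : ℝ, 0 < C ∧ ∀ z ∈ unitDisk, ∀ r ∈ Set.Ioc 0 (distBdry z),
        1 / MeasureTheory.volume.real (Metric.ball z r) *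
          ∫ ζ in Metric.ball z r, ‖f ζ - f z‖ ≤ C * (r / ω (r ^ α)) := by
  refine ⟨fun h => h.setAverage_le hα₁ hα₂ hω hω₀, ?_⟩
  rintro ⟨C, -, h⟩
  exact hf.isBlochType hg hα₁ hα₂ hω hω₀ h
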